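/- Let $\mathbb{D}=\{z\in\mathbb{C}:|z|<1\}$. For functions $f,g$ on $\mathbb{D}$ write $f\prec g$ ($f$ is subordinate to $g$) if there is an analytic function $w$ on $\mathbb{D}$ with $w(0)=0$, $|w(z)|<1$ and $f(z)=g(w(z))$ for all $z\in\mathbb{D}$. Put $$\phi_0(z)=1+\frac{z}{k}\cdot\frac{k+z}{k-z},\quad k=1+\sqrt2,\qquad \phi_{SG}(z)=\frac{2}{1+e^{-z}},\qquad \kappa=1-\sqrt2-2\log(2-\sqrt2),$$ $$\beta_0=\frac{(e+1)\,\kappa}{e-1},\qquad \beta_1=\frac{\kappa}{1+\log 2-\log(1+e)},\qquad \beta_2=\frac{2e\,\kappa}{e-1}.$$ Let $j\in\{0,1,2\}$ and let $\beta$ be real. If $\beta\ge\beta_j$, then for every analytic function $p$ on $\mathbb{D}$ with $p(0)=1$, $$1+\beta\,\frac{z\,p'(z)}{p(z)^j}\prec\phi_0(z)\quad\text{implies}\quad p(z)\prec\phi_{SG}(z).$$ The bounds are sharp: for each $j\in\{0,1,2\}$ and every $\beta$ with $0<\beta<\beta_j$ there is an analytic function $p$ on $\mathbb{D}$ with $p(0)=1$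 (and without zeros in $\mathbb{D}$ if $j\in\{1,2\}$) such that $1+\beta zp'(z)/p(z)^j\prec\phi_0(z)$ but $p\not\prec\phi_{SG}$. -/

import Mathlib

noncomputable section

namespace SigmoidSubordination

/-- The open unit disc of the complex plane. -/
def unitDisc : Set ℂ := Metric.ball 0 1

/-- Subordination `f ≺ g` on the unit disc: `f = g ∘ w` there for some analytic `w` with
`w 0 = 0` and `|w z| < 1`. -/
def Subordinate (f g : ℂ → ℂ) : Prop :=
  ∃ w : ℂ → ℂ, DifferentiableOn ℂ w unitDisc ∧ w 0 = 0 ∧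
    (∀ z ∈ unitDisc, ‖w z‖ < 1) ∧ ∀ z ∈ unitDisc, f z = g (w z)

/-- The rational function `1 + (z / k) * ((k + z) / (k - z))` with `k = 1 + √2`. -/
def phiZero (z : ℂ) : ℂ :=
  1 + z / ((1 + √2 : ℝ) : ℂ) * ((((1 + √2 : ℝ) : ℂ) + z) / (((1 + √2 : ℝ) : ℂ) - z))

/-- The modified sigmoid function `2 / (1 + e ^ (-z))`. -/
def phiSG (z : ℂ) : ℂ := 2 / (1 + Complex.exp (-z))

/-- `1 + β z p'(z)` -/
def Psi (β : ℝ) (p : ℂ → ℂ) (z : ℂ) : ℂ := 1 + β * (z * deriv p z)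

/-- `1 + β z p'(z) / p(z)` -/
def Lambda (β : ℝ) (p : ℂ → ℂ) (z : ℂ) : ℂ := 1 + β * (z * deriv p z / p z)

/-- `1 + β z p'(z) / p(z) ^ 2` -/
def Theta (β : ℝ) (p : ℂ → ℂ) (z : ℂ) : ℂ := 1 + β * (z * deriv p z / p z ^ 2)

/-- The constant `1 - √2 - 2 log (2 - √2)`. -/
def kappa : ℝ := 1 - √2 - 2 * Real.log (2 - √2)

/-- The threshold for `Psi`. -/
def betaPsi : ℝ := (Real.exp 1 + 1) * kappa / (Real.exp 1 - 1)

/-- The threshold for `Lambda`. -/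
def betaLambda : ℝ := kappa / (1 + Real.log 2 - Real.log (1 + Real.exp 1))

/-- The threshold for `Theta`. -/
def betaTheta : ℝ := 2 * Real.exp 1 * kappa / (Real.exp 1 - 1)

end SigmoidSubordination

end

/-! Write `f` for `z p' / p^j`. If `1 + β f = phiZero ∘ w`, then `f` vanishes at `0`, so `f = z P'`
with `P' = (w / z) * quotZero (w) / β`. Schwarz's lemma gives `|w / z| ≤ 1` and `|w| ≤ |z|`, and
`quotZero` is largest on the positive axis; integrating along rays yields `|P| < kappa / β`, where
`kappa` is the integral of `(phiZero t - 1) / t` over `[0, 1]` (`exists_primitive_of_subordinate`).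

For `j = 0, 1, 2` the equation integrates to `p = 1 + P`, `exp P`, `1 / (1 - P)`. These series have
nonnegative coefficients, so `|p - 1|` is at most its value at `|P|`. Each threshold is `kappa / c`,
where `P = c` gives `p = phiSG 1 = 1 + tanh (1/2)`. Hence `|p - 1| < tanh (1/2)`, and this disc
about `1` lies in the image of `phiSG` (`subordinate_phiSG_of_norm_sub_one_lt`).

For sharpness take `w z = r z`. If `β < kappa / c` and `r` is near `1`, then `P` reaches `c` inside
the disc, so `p` attains the forbidden value `phiSG 1` (`exists_extremal`, `not_subordinate_phiSG`).
-/

open Metric Set Filter Topology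

namespace SigmoidSubordination

/-! ### Integration along rays and uniqueness of primitives -/

/-- A radial fencing estimate: a bound on the derivative in terms of the modulus integrates to a
bound on the function. -/
lemma norm_le_of_norm_deriv_le_radial {F F' : ℂ → ℂ} {B B' : ℝ → ℝ}
    (hF : ∀ z : ℂ, ‖z‖ < 1 → HasDerivAt F (F' z) z) (hF0 : F 0 = 0)
    (hB : ∀ t : ℝ, 0 ≤ t → t < 1 → HasDerivAt B (B' t) t) (hB0 : B 0 = 0)
    (hbound : ∀ z : ℂ, ‖z‖ < 1 → ‖F' z‖ ≤ B' ‖z‖) {z : ℂ} (hz : ‖z‖ < 1) :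
    ‖F z‖ ≤ B ‖z‖ := by
  have hsz : ∀ s ∈ Icc (0 : ℝ) 1, s * ‖z‖ < 1 := fun s hs =>
    (mul_le_of_le_one_left (norm_nonneg z) hs.2).trans_lt hz
  have hnorm : ∀ s ∈ Icc (0 : ℝ) 1, ‖(s : ℂ) * z‖ = s * ‖z‖ := fun s hs => by
    rw [norm_mul, Complex.norm_real, Real.norm_of_nonneg hs.1]
  have hf : ∀ s ∈ Icc (0 : ℝ) 1,
      HasDerivAt (fun s : ℝ => F (s * z)) (F' (s * z) * z) s := fun s hs => by
    have h1 : HasDerivAt (fun x : ℂ => x * z) z (s : ℂ) := by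
      simpa using (hasDerivAt_id (s : ℂ)).mul_const z
    have h2 : HasDerivAt F (F' ((s : ℂ) * z)) ((s : ℂ) * z) :=
      hF _ ((hnorm s hs).trans_lt (hsz s hs))
    exact (h2.comp (s : ℂ) h1).comp_ofReal
  have hb : ∀ s ∈ Icc (0 : ℝ) 1,
      HasDerivAt (fun s : ℝ => B (s * ‖z‖)) (B' (s * ‖z‖) * ‖z‖) s := fun s hs => by
    have h1 : HasDerivAt (fun x : ℝ => x * ‖z‖) ‖z‖ s := by
      simpa using (hasDerivAt_id s).mul_const ‖z‖
    exact (hB _ (mul_nonneg hs.1 (norm_nonneg z)) (hsz s hs)).comp s h1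
  have key := image_norm_le_of_norm_deriv_right_le_deriv_boundary'
    (f := fun s : ℝ => F (s * z)) (f' := fun s : ℝ => F' (s * z) * z) (a := 0) (b := 1)
    (B := fun s : ℝ => B (s * ‖z‖)) (B' := fun s : ℝ => B' (s * ‖z‖) * ‖z‖)
    (fun s hs => (hf s hs).continuousAt.continuousWithinAt)
    (fun s hs => (hf s (Ico_subset_Icc_self hs)).hasDerivWithinAt)
    (by simp [hF0, hB0])
    (fun s hs => (hb s hs).continuousAt.continuousWithinAt)
    (fun s hs => (hb s (Ico_subset_Icc_self hs)).hasDerivWithinAt)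
    (fun s hs => by
      have hs' := Ico_subset_Icc_self hs
      rw [norm_mul, ← hnorm s hs']
      exact mul_le_mul_of_nonneg_right (hbound _ ((hnorm s hs').trans_lt (hsz s hs')))
        (norm_nonneg z))
  simpa using key (right_mem_Icc.2 zero_le_one)

/-- Two functions analytic on the unit disc agree if they agree at `0` and their derivatives agree
near `0`, except perhaps at `0` itself. -/
lemma eqOn_unitDisc_of_deriv_eq {f g h : ℂ → ℂ} (hf : DifferentiableOn ℂ f unitDisc)
    (hg : DifferentiableOn ℂ g unitDisc) (hh : AnalyticAt ℂ h 0) (h0 : h 0 = 0)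
    (hderiv : ∀ᶠ z in 𝓝[≠] (0 : ℂ), deriv h z = 0)
    (hfg : ∀ᶠ z in 𝓝 (0 : ℂ), h z = 0 → f z = g z) : EqOn f g unitDisc := by
  -- Cancelling `z` in `z p' = z P'` says nothing at `0`; isolated zeros of the analytic `deriv h`
  -- fill in that point.
  have hd : ∀ᶠ z in 𝓝 (0 : ℂ), deriv h z = 0 := by
    rcases hh.deriv.eventually_eq_zero_or_eventually_ne_zero with H | H
    · exact H
    · obtain ⟨z, hz1, hz2⟩ := (hderiv.and H).exists
      exact absurd hz1 hz2
  obtain ⟨ε, hε, hball⟩ := Metric.eventually_nhds_iff_ball.1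
    (hd.and hh.eventually_analyticAt)
  have hz : ∀ᶠ z in 𝓝 (0 : ℂ), h z = 0 := by
    filter_upwards [ball_mem_nhds (0 : ℂ) hε] with z hz
    rw [← h0]
    exact (convex_ball (0 : ℂ) ε).is_const_of_fderivWithin_eq_zero (𝕜 := ℂ)
      (fun x hx => (hball x hx).2.differentiableAt.differentiableWithinAt)
      (fun x hx => by
        rw [fderivWithin_of_isOpen isOpen_ball hx]
        ext
        simpa using (hball x hx).1) hz (mem_ball_self hε)
  refine (hf.analyticOnNhd isOpen_ball).eqOn_of_preconnected_of_eventuallyEq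
    (hg.analyticOnNhd isOpen_ball) (convex_ball (0 : ℂ) 1).isPreconnected
    (mem_ball_self one_pos) ?_
  filter_upwards [hz, hfg] with z h1 h2 using h2 h1

/-! ### The image of `phiSG` -/

lemma one_add_mem_slitPlane_of_norm_lt_one {u : ℂ} (hu : ‖u‖ < 1) : 1 + u ∈ Complex.slitPlane :=
  Complex.mem_slitPlane_of_norm_lt_one hu

lemma one_sub_mem_slitPlane_of_norm_lt_one {u : ℂ} (hu : ‖u‖ < 1) : 1 - u ∈ Complex.slitPlane := by
  simpa [sub_eq_add_neg] using one_add_mem_slitPlane_of_norm_lt_one (u := -u) (by simpa using hu)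

/-- The derivative is `2 / (1 - u^2)`, of modulus at most `2 / (1 - |u|^2)`. -/
lemma norm_log_sub_log_le {u : ℂ} (hu : ‖u‖ < 1) :
    ‖Complex.log (1 + u) - Complex.log (1 - u)‖ ≤
      Real.log (1 + ‖u‖) - Real.log (1 - ‖u‖) := by
  refine norm_le_of_norm_deriv_le_radial
    (F := fun u => Complex.log (1 + u) - Complex.log (1 - u))
    (F' := fun u => 1 / (1 + u) - -1 / (1 - u))
    (B := fun t => Real.log (1 + t) - Real.log (1 - t))
    (B' := fun t => 1 / (1 + t) - -1 / (1 - t)) ?_ (by simp) ?_ (by simp) ?_ hu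
  · intro z hz
    exact (((hasDerivAt_id z).const_add 1).clog (one_add_mem_slitPlane_of_norm_lt_one hz)).sub
      (((hasDerivAt_id z).const_sub 1).clog (one_sub_mem_slitPlane_of_norm_lt_one hz))
  · intro t h0 h1
    exact (((hasDerivAt_id t).const_add 1).log (by simp; linarith)).sub
      (((hasDerivAt_id t).const_sub 1).log (by simp; linarith))
  · intro z hz
    have h1 := Complex.slitPlane_ne_zero (one_add_mem_slitPlane_of_norm_lt_one hz)
    have h2 := Complex.slitPlane_ne_zero (one_sub_mem_slitPlane_of_norm_lt_one hz)
    have e1 : 1 / (1 + z) - -1 / (1 - z) = 2 / (1 - z ^ 2) := by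
      have : 1 - z ^ 2 ≠ 0 := by
        rw [show 1 - z ^ 2 = (1 + z) * (1 - z) by ring]; exact mul_ne_zero h1 h2
      field_simp
      ring
    have hn := norm_nonneg z
    have e2 : 1 / (1 + ‖z‖) - -1 / (1 - ‖z‖) = 2 / (1 - ‖z‖ ^ 2) := by
      have h3 : 1 + ‖z‖ ≠ 0 := by positivity
      have h4 : 1 - ‖z‖ ≠ 0 := by linarith
      have : 1 - ‖z‖ ^ 2 ≠ 0 := by
        rw [show 1 - ‖z‖ ^ 2 = (1 + ‖z‖) * (1 - ‖z‖) by ring]; exact mul_ne_zero h3 h4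
      field_simp
      ring
    rw [e1, e2, norm_div, Complex.norm_ofNat]
    have : 0 < 1 - ‖z‖ ^ 2 := by nlinarith
    gcongr
    calc 1 - ‖z‖ ^ 2 = ‖(1 : ℂ)‖ - ‖z ^ 2‖ := by simp
      _ ≤ ‖1 - z ^ 2‖ := norm_sub_norm_le _ _

/-- The disc of radius `tanh (1 / 2)` about `1` lies in the image of `phiSG`. -/
lemma subordinate_phiSG_of_norm_sub_one_lt {p : ℂ → ℂ} (hp : DifferentiableOn ℂ p unitDisc)
    (hp0 : p 0 = 1)
    (hbound : ∀ z ∈ unitDisc, ‖p z - 1‖ < (Real.exp 1 - 1) / (Real.exp 1 + 1)) :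
    Subordinate p phiSG := by
  have he : 1 < Real.exp 1 := Real.one_lt_exp_iff.2 one_pos
  have hlt : ∀ z ∈ unitDisc, ‖p z - 1‖ < 1 := fun z hz =>
    (hbound z hz).trans ((div_lt_one (by linarith)).2 (by linarith))
  -- Since `phiSG w = 1 + tanh (w / 2)`, the only choice vanishing at `0` is `w = 2 artanh (p - 1)`.
  refine ⟨fun z => Complex.log (1 + (p z - 1)) - Complex.log (1 - (p z - 1)), ?_, by simp [hp0],
    ?_, ?_⟩
  · refine DifferentiableOn.sub ?_ ?_
    · exact ((hp.sub_const 1).const_add 1).clog fun z hz =>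
        one_add_mem_slitPlane_of_norm_lt_one (hlt z hz)
    · exact ((hp.sub_const 1).const_sub 1).clog fun z hz =>
        one_sub_mem_slitPlane_of_norm_lt_one (hlt z hz)
  · intro z hz
    refine (norm_log_sub_log_le (hlt z hz)).trans_lt ?_
    have h0 := norm_nonneg (p z - 1)
    have h1 := hlt z hz
    have h2 := hbound z hz
    rw [← Real.log_div (by linarith) (by linarith), Real.log_lt_iff_lt_exp (by
      apply div_pos <;> linarith), div_lt_iff₀ (by linarith)]
    rw [lt_div_iff₀ (by linarith)] at h2
    linarith
  · intro z hz
    have h1 := Complex.slitPlane_ne_zero (one_add_mem_slitPlane_of_norm_lt_one (hlt z hz))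
    have h2 := Complex.slitPlane_ne_zero (one_sub_mem_slitPlane_of_norm_lt_one (hlt z hz))
    rw [phiSG, neg_sub, Complex.exp_sub, Complex.exp_log h1, Complex.exp_log h2]
    field_simp
    ring

/-- On the positive real axis, a function subordinate to `phiSG` stays below `phiSG 1`. -/
lemma not_subordinate_phiSG {p : ℂ → ℂ} {x : ℂ} (hx : x ∈ unitDisc)
    (hpx : p x = ((2 * Real.exp 1 / (1 + Real.exp 1) : ℝ) : ℂ)) : ¬ Subordinate p phiSG := by
  rintro ⟨w, -, -, hw, hpw⟩
  have he := Real.exp_pos 1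
  have h1 := hpw x hx
  have hwx := hw x hx
  set W := w x
  rw [hpx, phiSG] at h1
  have hne : 1 + Complex.exp (-W) ≠ 0 := by
    intro h0
    rw [h0, div_zero, Complex.ofReal_eq_zero] at h1
    exact absurd h1 (by positivity)
  have h2 : Complex.exp (-W) = ((Real.exp (-1) : ℝ) : ℂ) := by
    rw [eq_div_iff hne] at h1
    have he' : (Real.exp 1 : ℂ) ≠ 0 := by exact_mod_cast he.ne'
    have he1 : 1 + (Real.exp 1 : ℂ) ≠ 0 := by exact_mod_cast (by positivity : 1 + Real.exp 1 ≠ 0)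
    rw [Real.exp_neg]
    push_cast at h1 he' he1 ⊢
    field_simp at h1 ⊢
    linear_combination h1
  -- The modulus alone gives `Re W = 1`, with no branch of the logarithm.
  have h3 := congrArg norm h2
  rw [Complex.norm_exp, Complex.norm_real, Real.norm_of_nonneg (Real.exp_pos _).le,
    Real.exp_eq_exp, Complex.neg_re, neg_inj] at h3
  have := Complex.re_le_norm W
  linarith

/-! ### The primitive of `(phiZero z - 1) / z` -/

/-- The primitive `-a z - 2 log (1 - a z)`, `a = √2 - 1`, of `(phiZero z - 1) / z`. -/
noncomputable def primZero (z : ℂ) : ℂ := -((√2 - 1 : ℝ) * z) - 2 * Complex.log (1 - (√2 - 1 : ℝ) * z)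

/-- The restriction of `primZero` to the real axis. -/
noncomputable def primZeroReal (t : ℝ) : ℝ := -((√2 - 1) * t) - 2 * Real.log (1 - (√2 - 1) * t)

/-- The quotient `(phiZero z - 1) / z`. -/
noncomputable def quotZero (z : ℂ) : ℂ :=
  (√2 - 1 : ℝ) * (1 + (√2 - 1 : ℝ) * z) / (1 - (√2 - 1 : ℝ) * z)

/-- The restriction of `quotZero` to the real axis. -/
noncomputable def quotZeroReal (t : ℝ) : ℝ := (√2 - 1) * (1 + (√2 - 1) * t) / (1 - (√2 - 1) * t)

lemma sqrt_two_sub_one_pos : 0 < √2 - 1 := by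
  rw [sub_pos, Real.lt_sqrt zero_le_one]; norm_num

lemma sqrt_two_sub_one_lt_half : √2 - 1 < 1 / 2 := by
  have : √2 < 3 / 2 := by rw [Real.sqrt_lt' (by norm_num)]; norm_num
  linarith

lemma one_add_sqrt_two_mul : (1 + √2) * (√2 - 1) = 1 := by
  nlinarith [Real.sq_sqrt (show (0 : ℝ) ≤ 2 by norm_num)]

lemma norm_sqrt_two_sub_one_mul (z : ℂ) : ‖((√2 - 1 : ℝ) : ℂ) * z‖ = (√2 - 1) * ‖z‖ := by
  rw [norm_mul, Complex.norm_real, Real.norm_of_nonneg sqrt_two_sub_one_pos.le]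

/-- The pole of `phiZero` is at `1 + √2 > 2`. Working up to radius `2` includes the endpoint `t =
1`, where `kappa` is read off. -/
lemma norm_sqrt_two_sub_one_mul_lt_one {z : ℂ} (hz : ‖z‖ < 2) :
    ‖((√2 - 1 : ℝ) : ℂ) * z‖ < 1 := by
  rw [norm_sqrt_two_sub_one_mul]
  nlinarith [norm_nonneg z, sqrt_two_sub_one_pos, sqrt_two_sub_one_lt_half]

lemma one_sub_mul_pos {t : ℝ} (h0 : 0 ≤ t) (h2 : t < 2) : 0 < 1 - (√2 - 1) * t := by
  nlinarith [sqrt_two_sub_one_pos, sqrt_two_sub_one_lt_half]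

lemma phiZero_eq {z : ℂ} (hz : ‖z‖ < 2) : phiZero z = 1 + z * quotZero z := by
  have h1 := Complex.slitPlane_ne_zero
    (one_sub_mem_slitPlane_of_norm_lt_one (norm_sqrt_two_sub_one_mul_lt_one hz))
  have hk : ((1 + √2 : ℝ) : ℂ) * ((√2 - 1 : ℝ) : ℂ) = 1 := by
    exact_mod_cast one_add_sqrt_two_mul
  rw [phiZero, quotZero]
  generalize ((1 + √2 : ℝ) : ℂ) = k at *
  generalize ((√2 - 1 : ℝ) : ℂ) = a at *
  have hk0 : k ≠ 0 := left_ne_zero_of_mul_eq_one hk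
  obtain rfl : a = k⁻¹ := eq_inv_of_mul_eq_one_right hk
  have h2 : k - z ≠ 0 := by
    rw [show k - z = k * (1 - k⁻¹ * z) by field_simp]
    exact mul_ne_zero hk0 h1
  field_simp

lemma hasDerivAt_primZero {z : ℂ} (hz : ‖z‖ < 2) : HasDerivAt primZero (quotZero z) z := by
  have hs := one_sub_mem_slitPlane_of_norm_lt_one (norm_sqrt_two_sub_one_mul_lt_one hz)
  have h1 := Complex.slitPlane_ne_zero hs
  have hm : HasDerivAt (fun z : ℂ => ((√2 - 1 : ℝ) : ℂ) * z) ((√2 - 1 : ℝ) : ℂ) z := by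
    simpa using (hasDerivAt_id z).const_mul ((√2 - 1 : ℝ) : ℂ)
  convert! hm.neg.sub (((hm.const_sub 1).clog hs).const_mul 2) using 1
  rw [quotZero]
  field_simp
  ring

lemma hasDerivAt_primZeroReal {t : ℝ} (h0 : 0 ≤ t) (h2 : t < 2) :
    HasDerivAt primZeroReal (quotZeroReal t) t := by
  have h1 := (one_sub_mul_pos h0 h2).ne'
  have hm : HasDerivAt (fun t : ℝ => (√2 - 1) * t) (√2 - 1) t := by
    simpa using (hasDerivAt_id t).const_mul (√2 - 1)
  convert! hm.neg.sub (((hm.const_sub 1).log h1).const_mul 2) using 1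
  rw [quotZeroReal]
  field_simp
  ring

lemma primZero_zero : primZero 0 = 0 := by simp [primZero]

lemma primZeroReal_zero : primZeroReal 0 = 0 := by simp [primZeroReal]

lemma primZeroReal_one : primZeroReal 1 = kappa := by
  rw [primZeroReal, kappa, mul_one]
  ring_nf

lemma primZero_ofReal {t : ℝ} (h0 : 0 ≤ t) (h2 : t < 2) :
    primZero t = (primZeroReal t : ℂ) := by
  rw [primZero, primZeroReal]
  push_cast [Complex.ofReal_log (one_sub_mul_pos h0 h2).le]
  rfl

lemma continuousOn_primZeroReal : ContinuousOn primZeroReal (Icc 0 1) := fun _ ht =>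
  (hasDerivAt_primZeroReal ht.1 (by linarith [ht.2])).continuousAt.continuousWithinAt

lemma quotZeroReal_pos {t : ℝ} (h0 : 0 ≤ t) (h2 : t < 2) : 0 < quotZeroReal t := by
  have := sqrt_two_sub_one_pos
  exact div_pos (by positivity) (one_sub_mul_pos h0 h2)

lemma strictMonoOn_primZeroReal : StrictMonoOn primZeroReal (Icc 0 1) := by
  refine strictMonoOn_of_deriv_pos (convex_Icc 0 1) continuousOn_primZeroReal fun t ht => ?_
  rw [interior_Icc] at ht
  rw [(hasDerivAt_primZeroReal ht.1.le (by linarith [ht.2])).deriv]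
  exact quotZeroReal_pos ht.1.le (by linarith [ht.2])

lemma kappa_pos : 0 < kappa := by
  rw [← primZeroReal_one, ← primZeroReal_zero]
  exact strictMonoOn_primZeroReal (by simp) (by simp) one_pos

lemma norm_quotZero_le {z : ℂ} {t : ℝ} (hzt : ‖z‖ ≤ t) (ht : t < 2) :
    ‖quotZero z‖ ≤ quotZeroReal t := by
  have ha := sqrt_two_sub_one_pos
  have ht0 : 0 ≤ t := (norm_nonneg z).trans hzt
  rw [quotZero, quotZeroReal, norm_div, norm_mul, Complex.norm_real, Real.norm_of_nonneg ha.le]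
  have h1 : ‖1 + ((√2 - 1 : ℝ) : ℂ) * z‖ ≤ 1 + (√2 - 1) * t := by
    refine (norm_add_le _ _).trans ?_
    rw [norm_one, norm_sqrt_two_sub_one_mul]
    gcongr
  have h2 : 1 - (√2 - 1) * t ≤ ‖1 - ((√2 - 1 : ℝ) : ℂ) * z‖ := by
    refine le_trans ?_ (norm_sub_norm_le _ _)
    rw [norm_one, norm_sqrt_two_sub_one_mul]
    gcongr
  have h3 := one_sub_mul_pos ht0 ht
  gcongr

lemma norm_primZero_le {z : ℂ} (hz : ‖z‖ < 1) : ‖primZero z‖ ≤ primZeroReal ‖z‖ :=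
  norm_le_of_norm_deriv_le_radial (fun _ hz => hasDerivAt_primZero (by linarith)) primZero_zero
    (fun _ h0 h1 => hasDerivAt_primZeroReal h0 (by linarith)) primZeroReal_zero
    (fun _ hz => norm_quotZero_le le_rfl (by linarith)) hz

lemma differentiableAt_quotZero {z : ℂ} (hz : ‖z‖ < 2) : DifferentiableAt ℂ quotZero z := by
  have h1 := Complex.slitPlane_ne_zero
    (one_sub_mem_slitPlane_of_norm_lt_one (norm_sqrt_two_sub_one_mul_lt_one hz))
  unfold quotZero
  fun_prop (disch := exact h1)

/-! ### The implications at and above the thresholds -/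

/-- A function `f` with `1 + β f ≺ phiZero` has the form `f z = z P' z` with `P` of modulus less
than `kappa / β`. -/
lemma exists_primitive_of_subordinate {β : ℝ} (hβ : 0 < β) {f : ℂ → ℂ}
    (hf : Subordinate (fun z => 1 + β * f z) phiZero) :
    ∃ P P' : ℂ → ℂ, P 0 = 0 ∧ (∀ z ∈ unitDisc, HasDerivAt P (P' z) z) ∧
      (∀ z ∈ unitDisc, f z = z * P' z) ∧ ∀ z ∈ unitDisc, ‖P z‖ < kappa / β := by
  obtain ⟨w, hw, hw0, hw1, hfw⟩ := hf
  have hβ' : (β : ℂ) ≠ 0 := by exact_mod_cast hβ.ne'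
  have hmaps : MapsTo w (ball 0 1) (closedBall (w 0) 1) := fun z hz => by
    rw [hw0, mem_closedBall_zero_iff]; exact (hw1 z hz).le
  have hwz : ∀ z ∈ unitDisc, ‖w z‖ ≤ ‖z‖ := fun z hz =>
    Complex.norm_le_norm_of_mapsTo_ball hw (by simpa [hw0] using hmaps) hw0
      (mem_ball_zero_iff.1 hz)
  have hslope : ∀ z ∈ unitDisc, ‖dslope w 0 z‖ ≤ 1 := fun z hz => by
    simpa using Complex.norm_dslope_le_div_of_mapsTo_ball hw hmaps hz
  -- `dslope` is `w z / z` with the singularity at `0` removed.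
  have hG : DifferentiableOn ℂ (fun z => dslope w 0 z * quotZero (w z) / β) unitDisc := by
    refine (DifferentiableOn.mul ?_ ?_).div_const _
    · exact (Complex.differentiableOn_dslope (isOpen_ball.mem_nhds (mem_ball_self one_pos))).2 hw
    · exact fun z hz => (differentiableAt_quotZero
        (by linarith [hw1 z hz])).comp_differentiableWithinAt z (hw z hz)
  obtain ⟨P, hP⟩ := hG.isExactOn_ball.with_val_at 0 0
  have hP0 : P 0 = 0 := hP.1
  have hPd := hP.2
  refine ⟨P, _, hP0, hPd, fun z hz => ?_, fun z hz => ?_⟩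
  · have h1 := hfw z hz
    rw [phiZero_eq (by linarith [hw1 z hz])] at h1
    have h2 : z * dslope w 0 z = w z := by
      simpa [hw0] using sub_smul_dslope w 0 z
    have h3 : (β : ℂ) * f z = w z * quotZero (w z) := add_left_cancel h1
    field_simp
    rw [mul_comm (f z), h3, h2]
  · have hz' : ‖z‖ < 1 := mem_ball_zero_iff.1 hz
    refine lt_of_le_of_lt (norm_le_of_norm_deriv_le_radial
      (B := fun t => primZeroReal t / β) (B' := fun t => quotZeroReal t / β)
      (fun z hz => hPd z (mem_ball_zero_iff.2 hz)) hP0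
      (fun t h0 h1 => (hasDerivAt_primZeroReal h0 (by linarith)).div_const β)
      (by simp [primZeroReal_zero]) (fun u hu => ?_) hz') ?_
    · have hu' : u ∈ unitDisc := mem_ball_zero_iff.2 hu
      rw [norm_div, norm_mul, Complex.norm_real, Real.norm_of_nonneg hβ.le]
      gcongr
      calc ‖dslope w 0 u‖ * ‖quotZero (w u)‖ ≤ 1 * quotZeroReal ‖u‖ :=
            mul_le_mul (hslope u hu') (norm_quotZero_le (hwz u hu') (by linarith))
              (norm_nonneg _) zero_le_one
        _ = quotZeroReal ‖u‖ := one_mul _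
    · rw [← primZeroReal_one]
      exact div_lt_div_of_pos_right (strictMonoOn_primZeroReal ⟨norm_nonneg z, hz'.le⟩
        (by simp) hz') hβ

lemma eventually_mem_unitDisc : ∀ᶠ z in 𝓝 (0 : ℂ), z ∈ unitDisc :=
  ball_mem_nhds 0 one_pos

lemma analyticAt_zero {f : ℂ → ℂ} (hf : DifferentiableOn ℂ f unitDisc) : AnalyticAt ℂ f 0 :=
  hf.analyticAt eventually_mem_unitDisc

lemma hasDerivAt_of_mem_unitDisc {f : ℂ → ℂ} (hf : DifferentiableOn ℂ f unitDisc) {z : ℂ}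
    (hz : z ∈ unitDisc) : HasDerivAt f (deriv f z) z :=
  (hf.differentiableAt (isOpen_ball.mem_nhds hz)).hasDerivAt

lemma eventually_ne_zero {p : ℂ → ℂ} (hp : DifferentiableOn ℂ p unitDisc) (hp0 : p 0 = 1) :
    ∀ᶠ z in 𝓝 (0 : ℂ), p z ≠ 0 :=
  (analyticAt_zero hp).continuousAt.eventually_ne (by simp [hp0])

theorem subordinate_phiSG_of_Psi {β : ℝ} (hβ : betaPsi ≤ β) {p : ℂ → ℂ}
    (hp : DifferentiableOn ℂ p unitDisc) (hp0 : p 0 = 1) (hsub : Subordinate (Psi β p) phiZero) :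
    Subordinate p phiSG := by
  have he : 1 < Real.exp 1 := Real.one_lt_exp_iff.2 one_pos
  have hκ := kappa_pos
  have hpos : 0 < betaPsi := div_pos (by positivity) (by linarith)
  have hβ0 : 0 < β := hpos.trans_le hβ
  obtain ⟨P, P', hP0, hPd, hPf, hPn⟩ := exists_primitive_of_subordinate hβ0 hsub
  have hPdiff : DifferentiableOn ℂ P unitDisc := fun z hz =>
    (hPd z hz).differentiableAt.differentiableWithinAt
  have heq : EqOn p (fun z => 1 + P z) unitDisc := by
    refine eqOn_unitDisc_of_deriv_eq (h := fun z => p z - (1 + P z)) hp (hPdiff.const_add 1)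
      (analyticAt_zero (hp.sub (hPdiff.const_add 1))) (by simp [hp0, hP0]) ?_
      (Eventually.of_forall fun z hz => sub_eq_zero.1 hz)
    filter_upwards [self_mem_nhdsWithin, nhdsWithin_le_nhds eventually_mem_unitDisc] with z h1 h2
    refine ((hasDerivAt_of_mem_unitDisc hp h2).sub ((hPd z h2).const_add 1)).deriv.trans ?_
    rw [mul_left_cancel₀ h1 (hPf z h2), sub_self]
  refine subordinate_phiSG_of_norm_sub_one_lt hp hp0 fun z hz => ?_
  rw [heq hz]
  dsimp only
  rw [add_sub_cancel_left]
  refine (hPn z hz).trans_le ?_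
  rw [betaPsi, div_le_iff₀ (by linarith)] at hβ
  rw [div_le_div_iff₀ hβ0 (by linarith)]
  linarith

lemma log_threshold : 1 + Real.log 2 - Real.log (1 + Real.exp 1) =
    Real.log (2 * Real.exp 1 / (1 + Real.exp 1)) := by
  have he := Real.exp_pos 1
  rw [Real.log_div (by positivity) (by positivity), Real.log_mul (by norm_num) he.ne',
    Real.log_exp]
  ring

lemma log_threshold_pos : 0 < 1 + Real.log 2 - Real.log (1 + Real.exp 1) := by
  have he : 1 < Real.exp 1 := Real.one_lt_exp_iff.2 one_pos
  rw [log_threshold]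
  exact Real.log_pos ((one_lt_div (by linarith)).2 (by linarith))

/-- The Taylor coefficients of `exp` are nonnegative. -/
lemma norm_exp_sub_one_le_exp_norm_sub_one (z : ℂ) :
    ‖Complex.exp z - 1‖ ≤ Real.exp ‖z‖ - 1 := by
  simpa using Complex.norm_exp_sub_sum_le_exp_norm_sub_sum z 1

theorem subordinate_phiSG_of_Lambda {β : ℝ} (hβ : betaLambda ≤ β) {p : ℂ → ℂ}
    (hp : DifferentiableOn ℂ p unitDisc) (hp0 : p 0 = 1)
    (hsub : Subordinate (Lambda β p) phiZero) : Subordinate p phiSG := by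
  have he : 1 < Real.exp 1 := Real.one_lt_exp_iff.2 one_pos
  have hκ := kappa_pos
  have hβ0 : 0 < β := (div_pos hκ log_threshold_pos).trans_le hβ
  obtain ⟨P, P', hP0, hPd, hPf, hPn⟩ := exists_primitive_of_subordinate hβ0 hsub
  have hPdiff : DifferentiableOn ℂ P unitDisc := fun z hz =>
    (hPd z hz).differentiableAt.differentiableWithinAt
  -- Dividing by `p` is safe only near `0`, where `p ≠ 0`. The identity theorem spreads the formula
  -- to the disc, so `p` has no zeros there.
  have heq : EqOn p (fun z => Complex.exp (P z)) unitDisc := by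
    refine eqOn_unitDisc_of_deriv_eq (h := fun z => p z * Complex.exp (-P z) - 1) hp hPdiff.cexp
      (analyticAt_zero ((hp.mul hPdiff.neg.cexp).sub_const 1)) (by simp [hp0, hP0]) ?_
      (Eventually.of_forall fun z hz => ?_)
    · filter_upwards [self_mem_nhdsWithin, nhdsWithin_le_nhds eventually_mem_unitDisc,
        nhdsWithin_le_nhds (eventually_ne_zero hp hp0)] with z h1 h2 h3
      have h4 : deriv p z = p z * P' z := by
        have := hPf z h2
        rw [mul_div_assoc] at this
        rw [← mul_left_cancel₀ h1 this]
        field_simp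
      refine (((hasDerivAt_of_mem_unitDisc hp h2).mul
        (hPd z h2).neg.cexp).sub_const 1).deriv.trans ?_
      rw [h4]
      simp only [Pi.neg_apply]
      ring
    · rw [Complex.exp_neg, sub_eq_zero, mul_inv_eq_one₀ (Complex.exp_ne_zero _)] at hz
      exact hz
  refine subordinate_phiSG_of_norm_sub_one_lt hp hp0 fun z hz => ?_
  rw [heq hz]
  refine (norm_exp_sub_one_le_exp_norm_sub_one _).trans_lt ?_
  have h1 : kappa / β ≤ 1 + Real.log 2 - Real.log (1 + Real.exp 1) := by
    rw [betaLambda, div_le_iff₀ log_threshold_pos] at hβ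
    rwa [div_le_iff₀' hβ0]
  have h2 := Real.exp_lt_exp.2 ((hPn z hz).trans_le h1)
  rw [log_threshold, Real.exp_log (by positivity)] at h2
  calc Real.exp ‖P z‖ - 1 < 2 * Real.exp 1 / (1 + Real.exp 1) - 1 := by linarith
    _ = (Real.exp 1 - 1) / (Real.exp 1 + 1) := by
      field_simp
      ring

theorem subordinate_phiSG_of_Theta {β : ℝ} (hβ : betaTheta ≤ β) {p : ℂ → ℂ}
    (hp : DifferentiableOn ℂ p unitDisc) (hp0 : p 0 = 1)
    (hsub : Subordinate (Theta β p) phiZero) : Subordinate p phiSG := by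
  have he : 1 < Real.exp 1 := Real.one_lt_exp_iff.2 one_pos
  have hκ := kappa_pos
  have hpos : 0 < betaTheta := div_pos (by positivity) (by linarith)
  have hβ0 : 0 < β := hpos.trans_le hβ
  obtain ⟨P, P', hP0, hPd, hPf, hPn⟩ := exists_primitive_of_subordinate hβ0 hsub
  have hPdiff : DifferentiableOn ℂ P unitDisc := fun z hz =>
    (hPd z hz).differentiableAt.differentiableWithinAt
  have hPn' : ∀ z ∈ unitDisc, ‖P z‖ < (Real.exp 1 - 1) / (2 * Real.exp 1) := fun z hz => by
    refine (hPn z hz).trans_le ?_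
    rw [betaTheta, div_le_iff₀ (by linarith)] at hβ
    rw [div_le_div_iff₀ hβ0 (by positivity)]
    linarith
  have hPlt : ∀ z ∈ unitDisc, ‖P z‖ < 1 := fun z hz =>
    (hPn' z hz).trans ((div_lt_one (by positivity)).2 (by linarith))
  have hPne : ∀ z ∈ unitDisc, 1 - P z ≠ 0 := fun z hz =>
    Complex.slitPlane_ne_zero (one_sub_mem_slitPlane_of_norm_lt_one (hPlt z hz))
  have heq : EqOn p (fun z => (1 - P z)⁻¹) unitDisc := by
    refine eqOn_unitDisc_of_deriv_eq (h := fun z => (p z)⁻¹ - (1 - P z)) hp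
      ((hPdiff.const_sub 1).inv hPne)
      (((analyticAt_zero hp).inv (by simp [hp0])).sub (analyticAt_zero (hPdiff.const_sub 1)))
      (by simp [hp0, hP0]) ?_
      (Eventually.of_forall fun z hz => ?_)
    · filter_upwards [self_mem_nhdsWithin, nhdsWithin_le_nhds eventually_mem_unitDisc,
        nhdsWithin_le_nhds (eventually_ne_zero hp hp0)] with z h1 h2 h3
      have h4 := hPf z h2
      rw [mul_div_assoc] at h4
      refine (((hasDerivAt_of_mem_unitDisc hp h2).inv h3).sub
        ((hPd z h2).const_sub 1)).deriv.trans ?_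
      rw [← mul_left_cancel₀ h1 h4]
      ring
    · rw [← sub_eq_zero.1 hz, inv_inv]
  refine subordinate_phiSG_of_norm_sub_one_lt hp hp0 fun z hz => ?_
  have h0 := hPlt z hz
  have h1 := hPn' z hz
  -- The bound `t / (1 - t)` with `t = |P z|` equals `tanh (1/2)` at `t = (e - 1) / (2e)`.
  rw [heq hz, show (1 - P z)⁻¹ - 1 = P z / (1 - P z) by have := hPne z hz; field_simp; ring,
    norm_div]
  have h2 : 1 - ‖P z‖ ≤ ‖1 - P z‖ := by simpa using norm_sub_norm_le 1 (P z)
  rw [lt_div_iff₀ (by positivity)] at h1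
  rw [div_lt_div_iff₀ (by linarith) (by linarith)]
  nlinarith

/-! ### Sharpness -/

/-- Below the threshold, a rescaled copy `P` of `primZero / β` attains the critical value `c` while
staying in the unit disc. -/
lemma exists_extremal {β c : ℝ} (hβ : 0 < β) (hc0 : 0 < c) (hc1 : c < 1) (hc : c * β < kappa) :
    ∃ P P' w : ℂ → ℂ, P 0 = 0 ∧ (∀ z ∈ unitDisc, HasDerivAt P (P' z) z) ∧
      (∀ z ∈ unitDisc, ‖P z‖ < 1) ∧ (∃ x ∈ unitDisc, P x = c) ∧
      DifferentiableOn ℂ w unitDisc ∧ w 0 = 0 ∧ (∀ z ∈ unitDisc, ‖w z‖ < 1) ∧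
      ∀ z ∈ unitDisc, 1 + β * (z * P' z) = phiZero (w z) := by
  have hβ' : (β : ℂ) ≠ 0 := by exact_mod_cast hβ.ne'
  -- `d` will be `primZeroReal r`: `d < kappa` permits `r < 1`, `d < β` forces `|P| < 1`, and `c * β
  -- < d` puts the point `s / r` where `P = c` inside the disc.
  obtain ⟨d, hcd, hd⟩ : ∃ d, c * β < d ∧ d < min kappa β :=
    exists_between (lt_min hc (mul_lt_of_lt_one_left hβ hc1))
  obtain ⟨r, hr, hrd⟩ : d ∈ primZeroReal '' Ioo 0 1 := by
    refine intermediate_value_Ioo zero_le_one continuousOn_primZeroReal ?_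
    rw [primZeroReal_zero, primZeroReal_one]
    exact ⟨(mul_pos hc0 hβ).trans hcd, hd.trans_le (min_le_left _ _)⟩
  obtain ⟨s, hs, hsc⟩ : c * β ∈ primZeroReal '' Ioo 0 r := by
    refine intermediate_value_Ioo hr.1.le
      (continuousOn_primZeroReal.mono (Icc_subset_Icc_right hr.2.le)) ?_
    rw [primZeroReal_zero, hrd]
    exact ⟨mul_pos hc0 hβ, hcd⟩
  have hrz : ∀ z ∈ unitDisc, ‖(r : ℂ) * z‖ < r := fun z hz => by
    rw [norm_mul, Complex.norm_real, Real.norm_of_nonneg hr.1.le]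
    exact mul_lt_of_lt_one_right hr.1 (mem_ball_zero_iff.1 hz)
  have hw : ∀ z ∈ unitDisc, ‖(r : ℂ) * z‖ < 1 := fun z hz => (hrz z hz).trans hr.2
  refine ⟨fun z => primZero (r * z) / β, fun z => quotZero (r * z) * r / β, fun z => r * z,
    by simp [primZero_zero], fun z hz => ?_, fun z hz => ?_, ⟨((s / r : ℝ) : ℂ), ?_, ?_⟩,
    by fun_prop, by simp, hw, fun z hz => ?_⟩
  · have hm : HasDerivAt (fun z : ℂ => (r : ℂ) * z) (r : ℂ) z := by
      simpa using (hasDerivAt_id z).const_mul (r : ℂ)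
    exact ((hasDerivAt_primZero (by linarith [hw z hz])).comp z hm).div_const _
  · rw [norm_div, Complex.norm_real, Real.norm_of_nonneg hβ.le, div_lt_one hβ]
    calc ‖primZero (r * z)‖ ≤ primZeroReal ‖(r : ℂ) * z‖ := norm_primZero_le (hw z hz)
      _ ≤ primZeroReal r := strictMonoOn_primZeroReal.monotoneOn
          ⟨norm_nonneg _, (hw z hz).le⟩ (Ioo_subset_Icc_self hr) (hrz z hz).le
      _ < β := hrd ▸ hd.trans_le (min_le_right _ _)
  · rw [unitDisc, mem_ball_zero_iff, Complex.norm_real,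
      Real.norm_of_nonneg (div_nonneg hs.1.le hr.1.le)]
    exact (div_lt_one hr.1).2 hs.2
  · dsimp only
    rw [← Complex.ofReal_mul, mul_div_cancel₀ s hr.1.ne',
      primZero_ofReal hs.1.le (by linarith [hs.2, hr.2]), hsc]
    push_cast
    field_simp
  · rw [phiZero_eq (by linarith [hw z hz])]
    field_simp

theorem exists_not_subordinate_of_lt_betaPsi {β : ℝ} (hβ : 0 < β) (hlt : β < betaPsi) :
    ∃ p : ℂ → ℂ, DifferentiableOn ℂ p unitDisc ∧ p 0 = 1 ∧
      Subordinate (Psi β p) phiZero ∧ ¬ Subordinate p phiSG := by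
  have he : 1 < Real.exp 1 := Real.one_lt_exp_iff.2 one_pos
  -- `c` solves `1 + c = phiSG 1 = 2e / (1 + e)`.
  obtain ⟨P, P', w, hP0, hPd, -, ⟨x, hx, hPx⟩, hw, hw0, hw1, hPw⟩ :=
    exists_extremal (c := (Real.exp 1 - 1) / (Real.exp 1 + 1)) hβ
      (div_pos (by linarith) (by linarith)) ((div_lt_one (by linarith)).2 (by linarith)) (by
        rw [betaPsi, lt_div_iff₀ (by linarith)] at hlt
        rw [div_mul_eq_mul_div, div_lt_iff₀ (by linarith)]
        linarith)
  refine ⟨fun z => 1 + P z,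
    fun z hz => ((hPd z hz).const_add 1).differentiableAt.differentiableWithinAt, by simp [hP0],
    ⟨w, hw, hw0, hw1, fun z hz => ?_⟩, not_subordinate_phiSG hx ?_⟩
  · rw [← hPw z hz, Psi, ((hPd z hz).const_add 1).deriv]
  · rw [hPx]
    norm_cast
    field_simp
    ring

theorem exists_not_subordinate_of_lt_betaLambda {β : ℝ} (hβ : 0 < β) (hlt : β < betaLambda) :
    ∃ p : ℂ → ℂ, DifferentiableOn ℂ p unitDisc ∧ p 0 = 1 ∧ (∀ z ∈ unitDisc, p z ≠ 0) ∧
      Subordinate (Lambda β p) phiZero ∧ ¬ Subordinate p phiSG := by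
  have he : 1 < Real.exp 1 := Real.one_lt_exp_iff.2 one_pos
  -- Here `exp c = phiSG 1`.
  obtain ⟨P, P', w, hP0, hPd, -, ⟨x, hx, hPx⟩, hw, hw0, hw1, hPw⟩ :=
    exists_extremal (c := 1 + Real.log 2 - Real.log (1 + Real.exp 1)) hβ log_threshold_pos (by
        have := Real.log_lt_log two_pos (by linarith : 2 < 1 + Real.exp 1)
        linarith) (by
        rw [betaLambda, lt_div_iff₀ log_threshold_pos] at hlt
        linarith)
  refine ⟨fun z => Complex.exp (P z),
    fun z hz => (hPd z hz).cexp.differentiableAt.differentiableWithinAt, by simp [hP0],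
    fun z _ => Complex.exp_ne_zero _, ⟨w, hw, hw0, hw1, fun z hz => ?_⟩,
    not_subordinate_phiSG hx ?_⟩
  · rw [← hPw z hz, Lambda, (hPd z hz).cexp.deriv, mul_left_comm,
      mul_div_cancel_left₀ _ (Complex.exp_ne_zero _)]
  · rw [hPx, log_threshold, ← Complex.ofReal_exp, Real.exp_log (by positivity)]

theorem exists_not_subordinate_of_lt_betaTheta {β : ℝ} (hβ : 0 < β) (hlt : β < betaTheta) :
    ∃ p : ℂ → ℂ, DifferentiableOn ℂ p unitDisc ∧ p 0 = 1 ∧ (∀ z ∈ unitDisc, p z ≠ 0) ∧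
      Subordinate (Theta β p) phiZero ∧ ¬ Subordinate p phiSG := by
  have he : 1 < Real.exp 1 := Real.one_lt_exp_iff.2 one_pos
  -- Here `1 / (1 - c) = phiSG 1`; the bound `|P| < 1` keeps `1 - P` away from its zeros.
  obtain ⟨P, P', w, hP0, hPd, hP1, ⟨x, hx, hPx⟩, hw, hw0, hw1, hPw⟩ :=
    exists_extremal (c := (Real.exp 1 - 1) / (2 * Real.exp 1)) hβ
      (div_pos (by linarith) (by linarith)) ((div_lt_one (by linarith)).2 (by linarith)) (by
        rw [betaTheta, lt_div_iff₀ (by linarith)] at hlt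
        rw [div_mul_eq_mul_div, div_lt_iff₀ (by linarith)]
        linarith)
  have hne : ∀ z ∈ unitDisc, 1 - P z ≠ 0 := fun z hz =>
    Complex.slitPlane_ne_zero (one_sub_mem_slitPlane_of_norm_lt_one (hP1 z hz))
  have hd : ∀ z ∈ unitDisc,
      HasDerivAt (fun z => (1 - P z)⁻¹) (P' z / (1 - P z) ^ 2) z := fun z hz => by
    simpa using! ((hPd z hz).const_sub 1).inv (hne z hz)
  refine ⟨fun z => (1 - P z)⁻¹,
    fun z hz => (hd z hz).differentiableAt.differentiableWithinAt, by simp [hP0],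
    fun z hz => inv_ne_zero (hne z hz), ⟨w, hw, hw0, hw1, fun z hz => ?_⟩,
    not_subordinate_phiSG hx ?_⟩
  · have := hne z hz
    rw [← hPw z hz, Theta, (hd z hz).deriv]
    field_simp
  · rw [hPx]
    norm_cast
    have h1 : 1 - (Real.exp 1 - 1) / (2 * Real.exp 1) = (1 + Real.exp 1) / (2 * Real.exp 1) := by
      field_simp
      ring
    rw [h1, inv_div]

end SigmoidSubordination

theorem theorem2p12 :
    -- the three implications
    (∀ β : ℝ, SigmoidSubordination.betaPsi ≤ β →
      ∀ p : ℂ → ℂ, DifferentiableOn ℂ p SigmoidSubordination.unitDisc → p 0 = 1 →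
        SigmoidSubordination.Subordinate
          (SigmoidSubordination.Psi β p) SigmoidSubordination.phiZero →
        SigmoidSubordination.Subordinate p SigmoidSubordination.phiSG) ∧
    (∀ β : ℝ, SigmoidSubordination.betaLambda ≤ β →
      ∀ p : ℂ → ℂ, DifferentiableOn ℂ p SigmoidSubordination.unitDisc → p 0 = 1 →
        SigmoidSubordination.Subordinate
          (SigmoidSubordination.Lambda β p) SigmoidSubordination.phiZero →
        SigmoidSubordination.Subordinate p SigmoidSubordination.phiSG) ∧
    (∀ β : ℝ, SigmoidSubordination.betaTheta ≤ β →
      ∀ p : ℂ → ℂ, DifferentiableOn ℂ p SigmoidSubordination.unitDisc → p 0 = 1 →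
        SigmoidSubordination.Subordinate
          (SigmoidSubordination.Theta β p) SigmoidSubordination.phiZero →
        SigmoidSubordination.Subordinate p SigmoidSubordination.phiSG) ∧
    -- sharpness: below the threshold each implication fails
    (∀ β : ℝ, 0 < β → β < SigmoidSubordination.betaPsi →
      ∃ p : ℂ → ℂ, DifferentiableOn ℂ p SigmoidSubordination.unitDisc ∧ p 0 = 1 ∧
        SigmoidSubordination.Subordinate
          (SigmoidSubordination.Psi β p) SigmoidSubordination.phiZero ∧
        ¬ SigmoidSubordination.Subordinate p SigmoidSubordination.phiSG) ∧
    (∀ β : ℝ, 0 < β → β < SigmoidSubordination.betaLambda →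
      ∃ p : ℂ → ℂ, DifferentiableOn ℂ p SigmoidSubordination.unitDisc ∧ p 0 = 1 ∧
        (∀ z ∈ SigmoidSubordination.unitDisc, p z ≠ 0) ∧
        SigmoidSubordination.Subordinate
          (SigmoidSubordination.Lambda β p) SigmoidSubordination.phiZero ∧
        ¬ SigmoidSubordination.Subordinate p SigmoidSubordination.phiSG) ∧
    (∀ β : ℝ, 0 < β → β < SigmoidSubordination.betaTheta →
      ∃ p : ℂ → ℂ, DifferentiableOn ℂ p SigmoidSubordination.unitDisc ∧ p 0 = 1 ∧
        (∀ z ∈ SigmoidSubordination.unitDisc, p z ≠ 0) ∧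
        SigmoidSubordination.Subordinate
          (SigmoidSubordination.Theta β p) SigmoidSubordination.phiZero ∧
        ¬ SigmoidSubordination.Subordinate p SigmoidSubordination.phiSG) := by
  exact ⟨fun _ hβ _ => SigmoidSubordination.subordinate_phiSG_of_Psi hβ,
    fun _ hβ _ => SigmoidSubordination.subordinate_phiSG_of_Lambda hβ,
    fun _ hβ _ => SigmoidSubordination.subordinate_phiSG_of_Theta hβ,
    fun _ => SigmoidSubordination.exists_not_subordinate_of_lt_betaPsi,
    fun _ => SigmoidSubordination.exists_not_subordinate_of_lt_betaLambda,
    fun _ => SigmoidSubordination.exists_not_subordinate_of_lt_betaTheta⟩
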